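/- Let $X$ be a Banach space over $\mathbb{R}$ or $\mathbb{C}$, with dual $X^*$, and let $B_{X^*}$ be the closed unit ball of $X^*$. For $A\subset X^*$ denote by $\overline{A}^{\,*}$ the weak$^*$ closure of $A$, and let $$A^{(1)}=\bigcup_{n=1}^{\infty}\overline{A\cap nB_{X^*}}^{\,*}$$ be the weak$^*$ derived set of $A$, that is, the set of all limits of weak$^*$ convergent bounded nets in $A$. Suppose that $X$ is quasi-reflexive, i.e. the quotient $X^{**}/X$ of the bidual by the canonical image of $X$ is finite-dimensional, and that $A\subset X^*$ is absolutely convex (convex and balanced). Then $A^{(1)}=\overline{A}^{\,*}$. -/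

import Mathlib

open scoped ComplexOrder

/-- The weak-star closure, as a subset of `X^*`, of a set `A ⊆ X^*`. -/
def weakStarClosure (𝕜 : Type*) [RCLike 𝕜] (X : Type*) [NormedAddCommGroup X] [NormedSpace 𝕜 X]
    (A : Set (StrongDual 𝕜 X)) : Set (StrongDual 𝕜 X) :=
  StrongDual.toWeakDual ⁻¹' closure ((StrongDual.toWeakDual : StrongDual 𝕜 X → WeakDual 𝕜 X) '' A)

/-- The weak-star derived set `A^{(1)}`: the union over `n ≥ 1` of the weak-star closures of
`A ∩ n B_{X^*}`, where `n B_{X^*}` is the closed ball of radius `n` about `0` in the dual norm. -/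
def weakStarDerivedSet (𝕜 : Type*) [RCLike 𝕜] (X : Type*) [NormedAddCommGroup X]
    [NormedSpace 𝕜 X] (A : Set (StrongDual 𝕜 X)) : Set (StrongDual 𝕜 X) :=
  ⋃ n : ℕ, ⋃ _ : 1 ≤ n,
    weakStarClosure 𝕜 X (A ∩ Metric.closedBall (0 : StrongDual 𝕜 X) (n : ℝ))

/-- The cokernel `Y^* / f(X)` of a bounded linear map `f : X → Y^*` is finite-dimensional. -/
def HasFiniteDimensionalCokernel {𝕜 : Type*} [RCLike 𝕜] {X Y : Type*} [NormedAddCommGroup X]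
    [NormedSpace 𝕜 X] [NormedAddCommGroup Y] [NormedSpace 𝕜 Y] (f : X →L[𝕜] StrongDual 𝕜 Y) :
    Prop :=
  FiniteDimensional 𝕜 (StrongDual 𝕜 Y ⧸ f.range)

/-- `X` is quasi-reflexive: the quotient `X^{**} / X`, by the canonical image of `X` in its
bidual, is finite-dimensional (this is the preceding definition with `Y = X^*`). -/
def IsQuasiReflexive (𝕜 : Type*) [RCLike 𝕜] (X : Type*) [NormedAddCommGroup X]
    [NormedSpace 𝕜 X] : Prop :=
  HasFiniteDimensionalCokernel (Y := StrongDual 𝕜 X) (NormedSpace.inclusionInDoubleDual 𝕜 X)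

open scoped Pointwise

/-! ### Separation and the weak-star bipolar theorem -/

section WeakStarClosure

variable {𝕜 : Type*} [RCLike 𝕜]

/-! By the bipolar theorem, it suffices to find `n` such that `‖x‖ ≤ c` on `A ∩ nB` forces `‖φ x‖ ≤
c`, for `φ` in the closure. Hahn-Banach splits `x = f + h` in `X**` with `‖f a‖ + n‖h‖ ≤ c` on `A`
(`AbsConvex.exists_norm_sub_add_norm_le`), but `f` need not lie in `X`, so it cannot be tested on
`φ`. As `X**/X` is finite-dimensional, some `g ≡ h` mod `X` has `‖g‖ ≤ C‖h‖` on `A ∪ {φ}`, with `C`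
independent of `x` and `n` (`exists_forall_exists_sub_mem_norm_le`). Then `f + g` lies in `X`, its
bound on `A` passes to `φ`, and a large `n` absorbs the error, a multiple of `‖h‖`. -/

theorem Convex.real_of_rclike {E : Type*} [AddCommGroup E] [Module 𝕜 E] [Module ℝ E]
    [IsScalarTower ℝ 𝕜 E] {s : Set E} (hs : Convex 𝕜 s) : Convex ℝ s := by
  rw [convex_iff_forall_pos] at hs ⊢
  intro x hx y hy a b ha hb hab
  have := hs hx hy (a := (a : 𝕜)) (b := (b : 𝕜)) (by exact_mod_cast ha) (by exact_mod_cast hb)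
    (by exact_mod_cast hab)
  simpa only [RCLike.real_smul_eq_coe_smul (K := 𝕜)] using this

/-- If a functional has real part less than `u` on a balanced set, then its norm is at most `u`
there. -/
theorem Balanced.norm_le_of_re_le {E : Type*} [SMul 𝕜 E] {s : Set E}
    (hs : Balanced 𝕜 s) {f : E → 𝕜} (hmul : ∀ (c : 𝕜) (a : E), f (c • a) = c * f a) {u : ℝ} (hf : ∀ a ∈ s, RCLike.re (f a) ≤ u)
    {a : E} (ha : a ∈ s) : ‖f a‖ ≤ u := by
  obtain ⟨c, hc, hca⟩ := RCLike.exists_norm_mul_eq_self (f a)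
  have hc0 : c ≠ 0 := by rintro rfl; simp at hc
  have hm : c⁻¹ • a ∈ s := hs.smul_mem (by simp [hc]) ha
  have h := hf _ hm
  rw [hmul] at h
  have : c⁻¹ * f a = (‖f a‖ : 𝕜) := by
    rw [inv_mul_eq_iff_eq_mul₀ hc0, hca]
  rwa [this, RCLike.ofReal_re] at h

/-- Separation of a point from a convex set in the weak topology of a bilinear pairing. -/
theorem exists_re_lt_of_notMem_closure {E F : Type*} [AddCommGroup E] [Module 𝕜 E]
    [AddCommGroup F] [Module 𝕜 F] (B : E →ₗ[𝕜] F →ₗ[𝕜] 𝕜) {s : Set (WeakBilin B)}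
    (hs : Convex 𝕜 s) {z : WeakBilin B} (hz : z ∉ closure s) :
    ∃ (x : F) (u : ℝ), (∀ a ∈ s, RCLike.re (B a x) < u) ∧ u < RCLike.re (B z x) := by
  let _ : Module ℝ E := Module.restrictScalars ℝ 𝕜 E
  have : IsScalarTower ℝ 𝕜 E := IsScalarTower.restrictScalars ℝ 𝕜 E
  let _ : Module ℝ (WeakBilin B) := inferInstanceAs (Module ℝ E)
  have : IsScalarTower ℝ 𝕜 (WeakBilin B) := inferInstanceAs (IsScalarTower ℝ 𝕜 E)
  have : LocallyConvexSpace ℝ (WeakBilin B) := WeakBilin.locallyConvexSpace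
  have : ContinuousSMul ℝ (WeakBilin B) := IsScalarTower.continuousSMul 𝕜
  obtain ⟨f, u, hu, hfu⟩ := RCLike.geometric_hahn_banach_closed_point (𝕜 := 𝕜)
    hs.real_of_rclike.closure isClosed_closure hz
  obtain ⟨x, rfl⟩ := LinearMap.dualEmbedding_surjective B f
  exact ⟨x, u, fun a ha ↦ hu a (subset_closure ha), hfu⟩

variable {X : Type*} [NormedAddCommGroup X] [NormedSpace 𝕜 X]

theorem norm_apply_le_of_mem_weakStarClosure {A : Set (StrongDual 𝕜 X)} {φ : StrongDual 𝕜 X}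
    (hφ : φ ∈ weakStarClosure 𝕜 X A) {x : X} {c : ℝ} (hc : ∀ a ∈ A, ‖a x‖ ≤ c) : ‖φ x‖ ≤ c := by
  have hcl : IsClosed {ψ : WeakDual 𝕜 X | ‖ψ x‖ ≤ c} := by
    have h1 : Continuous fun ψ : WeakDual 𝕜 X ↦ ‖ψ x‖ := (WeakDual.eval_continuous x).norm
    exact isClosed_le h1 continuous_const
  have hsub : (StrongDual.toWeakDual : StrongDual 𝕜 X → WeakDual 𝕜 X) '' A ⊆
      {ψ : WeakDual 𝕜 X | ‖ψ x‖ ≤ c} := by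
    rintro _ ⟨a, ha, rfl⟩
    exact hc a ha
  exact closure_minimal hsub hcl hφ

/-- The bipolar theorem for the weak-star topology. -/
theorem mem_weakStarClosure_of_forall_norm_apply_le {A : Set (StrongDual 𝕜 X)}
    (hA : AbsConvex 𝕜 A) {φ : StrongDual 𝕜 X}
    (h : ∀ (x : X) (c : ℝ), (∀ a ∈ A, ‖a x‖ ≤ c) → ‖φ x‖ ≤ c) :
    φ ∈ weakStarClosure 𝕜 X A := by
  by_contra hφ
  let B : StrongDual 𝕜 X →ₗ[𝕜] X →ₗ[𝕜] 𝕜 := topDualPairing 𝕜 X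
  let S : Set (WeakBilin B) := A
  have hφS : (φ : WeakBilin B) ∉ closure S := by
    intro hmem
    refine hφ ?_
    have hS : (StrongDual.toWeakDual : StrongDual 𝕜 X → WeakDual 𝕜 X) '' A = A := Set.image_id _
    rw [weakStarClosure, hS]
    exact hmem
  obtain ⟨x, u, hu, hfu⟩ := exists_re_lt_of_notMem_closure B hA.2 hφS
  exact absurd (((RCLike.re_le_norm _).trans (h x u fun a ha ↦
    hA.1.norm_le_of_re_le (f := fun a ↦ a x) (fun _ _ ↦ rfl) (fun b hb ↦ (hu b hb).le) ha))) (not_le.2 hfu)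

end WeakStarClosure

/-! ### Splitting functionals and correcting them modulo finite codimension -/

section Decomposition

variable {𝕜 : Type*} [RCLike 𝕜] {Y : Type*} [NormedAddCommGroup Y] [NormedSpace 𝕜 Y]

theorem AbsConvex.exists_pos_mem_smul_of_mem_span {A : Set Y} [Module ℝ Y] [IsScalarTower ℝ 𝕜 Y]
    (hA : AbsConvex 𝕜 A) (hne : A.Nonempty)
    {v : Y} (hv : v ∈ Submodule.span 𝕜 A) : ∃ r : ℝ, 0 < r ∧ v ∈ r • A := by
  have hconv : Convex ℝ A := hA.2.real_of_rclike
  induction hv using Submodule.span_induction with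
  | mem x hx => exact ⟨1, one_pos, by simpa using hx⟩
  | zero => exact ⟨1, one_pos, by simpa using hA.1.zero_mem hne⟩
  | add x y _ _ hx hy =>
    obtain ⟨r, hr, hx⟩ := hx
    obtain ⟨s, hs, hy⟩ := hy
    refine ⟨r + s, add_pos hr hs, ?_⟩
    rw [hconv.add_smul hr.le hs.le]
    exact Set.add_mem_add hx hy
  | smul a x _ hx =>
    obtain ⟨r, hr, y, hy, rfl⟩ := hx
    have h1 : 0 < ‖a‖ + 1 := by positivity
    refine ⟨(‖a‖ + 1) * r, by positivity, (((‖a‖ + 1 : ℝ) : 𝕜)⁻¹ * a) • y,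
      hA.1.smul_mem ?_ hy, ?_⟩
    · rw [norm_mul, norm_inv, RCLike.norm_ofReal, abs_of_pos h1, inv_mul_le_iff₀ h1]
      linarith
    · have h2 : ((‖a‖ + 1 : ℝ) : 𝕜) ≠ 0 := by exact_mod_cast h1.ne'
      simp only [RCLike.real_smul_eq_coe_smul (K := 𝕜), smul_smul]
      congr 1
      rw [RCLike.ofReal_mul]
      field_simp

theorem AbsConvex.of_smul_mem {A : Set Y} (h : ∀ c : 𝕜, ‖c‖ ≤ 1 → ∀ a ∈ A, c • a ∈ A)
    (hA : Convex 𝕜 A) : AbsConvex 𝕜 A :=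
  ⟨balanced_iff_smul_mem.2 fun {c} hc {a} ha ↦ h c hc a ha, hA⟩

theorem absConvex_closedBall_zero {r : ℝ} : AbsConvex 𝕜 (Metric.closedBall (0 : Y) r) := by
  refine ⟨balanced_closedBall_zero, fun y hy z hz a b ha hb hab ↦ ?_⟩
  rw [mem_closedBall_zero_iff] at hy hz ⊢
  have hab' : ‖a‖ + ‖b‖ = 1 := by
    rw [← RCLike.norm_of_nonneg' ha, ← RCLike.norm_of_nonneg' hb] at hab
    exact_mod_cast hab
  calc ‖a • y + b • z‖ ≤ ‖a‖ * ‖y‖ + ‖b‖ * ‖z‖ := by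
        simpa only [norm_smul] using norm_add_le (a • y) (b • z)
    _ ≤ ‖a‖ * r + ‖b‖ * r := by gcongr
    _ = r := by rw [← add_mul, hab', one_mul]

/-- A functional bounded by `c` on the intersection of an absolutely convex set `A` with the ball
of radius `r` splits as a functional bounded on `A` plus one bounded on the ball, the two bounds
adding up to `c`. -/
theorem AbsConvex.exists_norm_sub_add_norm_le {A : Set Y} (hA : AbsConvex 𝕜 A) (hne : A.Nonempty)
    {r c : ℝ} (hr : 0 < r) (x : StrongDual 𝕜 Y)
    (hx : ∀ a ∈ A ∩ Metric.closedBall 0 r, ‖x a‖ ≤ c) :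
    ∃ h : StrongDual 𝕜 Y, ∀ a ∈ A, ‖x a - h a‖ + r * ‖h‖ ≤ c := by
  let _ : Module ℝ Y := Module.restrictScalars ℝ 𝕜 Y
  have : IsScalarTower ℝ 𝕜 Y := IsScalarTower.restrictScalars ℝ 𝕜 Y
  have h0A : (0 : Y) ∈ A := hA.1.zero_mem hne
  have hc : 0 ≤ c := by simpa using hx 0 ⟨h0A, by simpa using hr.le⟩
  -- `A` is absorbent only in its span, so its gauge is taken there.
  let V : Submodule 𝕜 Y := Submodule.span 𝕜 A
  let A' : Set V := V.subtype ⁻¹' A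
  have hbal : Balanced 𝕜 A' := by
    rw [balanced_iff_smul_mem]
    intro a ha v hv
    exact hA.1.smul_mem ha hv
  have hconv : Convex 𝕜 A' := hA.2.linear_preimage V.subtype
  have hconvR : Convex ℝ A' := hconv.real_of_rclike
  have hmem : ∀ (v : V) (t : ℝ), 0 < t → (v : Y) ∈ t • A → v ∈ t • A' := by
    intro v t ht hv
    rw [Set.mem_smul_set_iff_inv_smul_mem₀ ht.ne'] at hv ⊢
    exact hv
  have hbalR : Balanced ℝ A' := by
    rw [balanced_iff_smul_mem]
    intro a ha v hv
    rw [RCLike.real_smul_eq_coe_smul (K := 𝕜)]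
    exact hbal.smul_mem (by simpa using ha) hv
  have habs : Absorbent ℝ A' := by
    intro v
    obtain ⟨t, ht, hv⟩ := hA.exists_pos_mem_smul_of_mem_span hne v.2
    refine absorbs_iff_norm.2 ⟨t, fun d hd ↦ ?_⟩
    rw [Set.singleton_subset_iff]
    exact hbalR.smul_mono (by rwa [Real.norm_of_nonneg ht.le]) (hmem v t ht hv)
  let q : Seminorm 𝕜 V := gaugeSeminorm hbal hconvR habs
  have hq : ∀ v : V, (v : Y) ∈ A → q v ≤ 1 := fun v hv ↦ gauge_le_one_of_mem hv
  -- A maximum of seminorms on the product, so that domination by it bounds the sum of the two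
  -- component norms.
  let p : Seminorm 𝕜 (V × Y) := c.toNNReal •
    (q.comp (LinearMap.fst 𝕜 V Y) ⊔ (r⁻¹.toNNReal • normSeminorm 𝕜 Y).comp (LinearMap.snd 𝕜 V Y))
  have hp : ∀ v w, p (v, w) = c * max (q v) (r⁻¹ * ‖w‖) := by
    intro v w
    simp [p, NNReal.smul_def, hc, hr.le]
  have hxq : ∀ v : V, ‖x v‖ ≤ c * max (q v) (r⁻¹ * ‖(v : Y)‖) := by
    intro v
    have key : ∀ t, max (q v) (r⁻¹ * ‖(v : Y)‖) < t → ‖x v‖ ≤ c * t := by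
      intro t ht
      obtain ⟨ht1, ht2⟩ := max_lt_iff.1 ht
      obtain ⟨s, hs, hst, hvs⟩ := exists_lt_of_gauge_lt habs (show gauge A' v < t from ht1)
      have ht0 : 0 < t := hs.trans hst
      have hvt : v ∈ t • A' :=
        hbalR.smul_mono (by rw [Real.norm_of_nonneg hs.le, Real.norm_of_nonneg ht0.le]; exact hst.le)
          hvs
      rw [Set.mem_smul_set_iff_inv_smul_mem₀ ht0.ne'] at hvt
      have hball : ‖((t : 𝕜)⁻¹ • (v : Y))‖ ≤ r := by
        rw [norm_smul, norm_inv, RCLike.norm_ofReal, abs_of_pos ht0, inv_mul_le_iff₀ ht0]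
        rw [inv_mul_lt_iff₀ hr] at ht2
        linarith
      have hin : ((t : 𝕜)⁻¹ • (v : Y)) ∈ A := by
        rw [RCLike.real_smul_eq_coe_smul (K := 𝕜), RCLike.ofReal_inv] at hvt
        exact hvt
      have := hx _ ⟨hin, by simpa using hball⟩
      rw [map_smul, norm_smul, norm_inv, RCLike.norm_ofReal, abs_of_pos ht0,
        inv_mul_le_iff₀ ht0] at this
      linarith
    refine le_of_forall_gt_imp_ge_of_dense fun b hb ↦ ?_
    rcases hc.eq_or_lt with rfl | hc0
    · have := key _ (lt_add_one _)
      simp only [zero_mul] at this hb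
      exact this.trans hb.le
    · have := key (b / c) (by rwa [lt_div_iff₀ hc0, mul_comm])
      rwa [mul_div_cancel₀ _ hc0.ne'] at this
  -- On the diagonal, `x` is dominated by `p`; the components of an extension `F` to the product
  -- split `x`.
  let D : V →ₗ[𝕜] V × Y := LinearMap.prod LinearMap.id V.subtype
  have hD : Function.Injective D := fun v w hvw ↦ congrArg Prod.fst hvw
  let e := LinearEquiv.ofInjective D hD
  obtain ⟨F, hF, hFp⟩ := Module.Dual.exists_extension_of_le_seminorm (LinearMap.range D)
    ((x.toLinearMap ∘ₗ V.subtype) ∘ₗ e.symm.toLinearMap) (p := p) (by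
      intro z
      obtain ⟨v, rfl⟩ := e.surjective z
      have : ((e v : LinearMap.range D) : V × Y) = (v, (v : Y)) := rfl
      rw [this, hp]
      simpa using hxq v)
  have hFx : ∀ v : V, F (v, (v : Y)) = x v := by
    intro v
    have := hF (e v)
    rw [LinearMap.comp_apply, LinearEquiv.coe_coe, e.symm_apply_apply] at this
    exact this
  have hFb : ∀ w, ‖F (0, w)‖ ≤ c * r⁻¹ * ‖w‖ := by
    intro w
    have := hFp (0, w)
    rw [hp, map_zero, max_eq_right (by positivity)] at this
    linarith
  let h : StrongDual 𝕜 Y := (F ∘ₗ LinearMap.inr 𝕜 V Y).mkContinuous (c * r⁻¹) hFb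
  have hh : ∀ w, h w = F (0, w) := fun w ↦ rfl
  refine ⟨h, fun a ha ↦ ?_⟩
  let v : V := ⟨a, Submodule.subset_span ha⟩
  have hsub : x a - h a = F (v, 0) := by
    rw [hh, ← hFx v, ← map_sub]
    simp [v]
  -- Independent phases for the two components make both values nonnegative, so their norms add.
  have hsum : ∀ w, ‖w‖ ≤ r → ‖F (v, 0)‖ + ‖h w‖ ≤ c := by
    intro w hw
    obtain ⟨α, hα, hα'⟩ := RCLike.exists_norm_mul_eq_self (F (v, 0))
    obtain ⟨β, hβ, hβ'⟩ := RCLike.exists_norm_mul_eq_self (h w)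
    have hα0 : α ≠ 0 := by rintro rfl; simp at hα
    have hβ0 : β ≠ 0 := by rintro rfl; simp at hβ
    have h1 : F (α⁻¹ • v, β⁻¹ • w) = ((‖F (v, 0)‖ + ‖h w‖ : ℝ) : 𝕜) := by
      have : ((α⁻¹ • v, β⁻¹ • w) : V × Y) = α⁻¹ • (v, 0) + β⁻¹ • (0, w) := by simp
      rw [this, map_add, map_smul, map_smul, ← hh, RCLike.ofReal_add, smul_eq_mul, smul_eq_mul]
      congr 1
      · rw [inv_mul_eq_iff_eq_mul₀ hα0, hα']
      · rw [inv_mul_eq_iff_eq_mul₀ hβ0, hβ']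
    have h2 := hFp (α⁻¹ • v, β⁻¹ • w)
    rw [h1, hp, RCLike.norm_ofReal, abs_of_nonneg (by positivity), map_smul_eq_mul, norm_smul,
      norm_inv, norm_inv, hα, hβ] at h2
    refine h2.trans (mul_le_of_le_one_right hc (max_le (by simpa using hq v ha) ?_))
    rw [inv_mul_le_iff₀ hr]
    simpa using hw
  have hcF : 0 ≤ c - ‖F (v, 0)‖ := by
    have := hsum 0 (by simpa using hr.le)
    rw [map_zero, norm_zero] at this
    linarith
  have hnorm : ‖h‖ ≤ (c - ‖F (v, 0)‖) / r := by
    refine h.opNorm_le_bound (by positivity) fun w ↦ ?_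
    rcases eq_or_ne w 0 with rfl | hw
    · simp
    have hw' : 0 < ‖w‖ := norm_pos_iff.2 hw
    have hnw : ‖((r / ‖w‖ : ℝ) : 𝕜)‖ = r / ‖w‖ := by
      rw [RCLike.norm_ofReal, abs_of_nonneg (by positivity)]
    have := hsum (((r / ‖w‖ : ℝ) : 𝕜) • w) (by
      rw [norm_smul, hnw, div_mul_cancel₀ _ hw'.ne'])
    rw [map_smul, norm_smul, hnw] at this
    rw [div_mul_eq_mul_div, le_div_iff₀ hr]
    have h3 : r / ‖w‖ * ‖h w‖ ≤ c - ‖F (v, 0)‖ := by linarith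
    rw [div_mul_eq_mul_div, div_le_iff₀ hw'] at h3
    linarith
  rw [le_div_iff₀ hr] at hnorm
  rw [hsub]
  linarith

/-- Modulo a closed subspace `M` of finite codimension, a vector `h` congruent to one on which the
family `Φ` of functionals is bounded is congruent to one on which the bound is controlled by the
norm of `h`. -/
theorem exists_forall_exists_sub_mem_norm_le {ι : Type*} (M : Submodule 𝕜 Y)
    (hM : IsClosed (M : Set Y)) [FiniteDimensional 𝕜 (Y ⧸ M)] (Φ : ι → Y →ₗ[𝕜] 𝕜) :
    ∃ C : ℝ, 0 ≤ C ∧ ∀ f h : Y, (∃ c : ℝ, ∀ i, ‖Φ i f‖ ≤ c) → f + h ∈ M →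
      ∃ g : Y, h - g ∈ M ∧ ∀ i, ‖Φ i g‖ ≤ C * ‖h‖ := by
  have : IsClosed (M : Set Y) := hM
  let P : Submodule 𝕜 Y :=
    { carrier := {f | ∃ c : ℝ, ∀ i, ‖Φ i f‖ ≤ c}
      zero_mem' := ⟨0, fun i ↦ by simp⟩
      add_mem' := by
        rintro f g ⟨c, hc⟩ ⟨d, hd⟩
        refine ⟨c + d, fun i ↦ ?_⟩
        rw [map_add]
        exact (norm_add_le _ _).trans (add_le_add (hc i) (hd i))
      smul_mem' := by
        rintro k f ⟨c, hc⟩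
        refine ⟨‖k‖ * c, fun i ↦ ?_⟩
        rw [map_smul, norm_smul]
        exact mul_le_mul_of_nonneg_left (hc i) (norm_nonneg _) }
  let T : P →ₗ[𝕜] Y ⧸ M := M.mkQ ∘ₗ P.subtype
  -- `P` need not be closed, but its image in `Y ⧸ M` is finite-dimensional: a linear section
  -- composed with `Φ` is a pointwise bounded family there, and Banach-Steinhaus gives `C`.
  obtain ⟨s, hs⟩ := T.rangeRestrict.exists_rightInverse_of_surjective T.range_rangeRestrict
  have : CompleteSpace (LinearMap.range T) := FiniteDimensional.complete 𝕜 _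
  let G : ι → LinearMap.range T →L[𝕜] 𝕜 := fun i ↦ LinearMap.toContinuousLinearMap
    (Φ i ∘ₗ P.subtype ∘ₗ s)
  obtain ⟨C, hC⟩ := banach_steinhaus (g := G) (fun e ↦ (s e).2)
  refine ⟨max C 0, le_max_right _ _, fun f h hf hfh ↦ ?_⟩
  -- `f + h ∈ M` puts the class of `h` in the range of `T`, as that of `-f`.
  let e : LinearMap.range T := T.rangeRestrict (-⟨f, hf⟩)
  have he : (e : Y ⧸ M) = M.mkQ h := by
    have h0 : M.mkQ (f + h) = 0 := (Submodule.Quotient.mk_eq_zero M).2 hfh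
    rw [map_add] at h0
    change T (-⟨f, hf⟩) = _
    rw [map_neg]
    exact neg_eq_of_add_eq_zero_right h0
  have hse : M.mkQ (s e : Y) = M.mkQ h := by
    rw [← he]
    exact congrArg Subtype.val (LinearMap.congr_fun hs e)
  refine ⟨s e, ?_, fun i ↦ ?_⟩
  · exact (Submodule.Quotient.eq M).1 hse.symm
  · have h1 : ‖G i e‖ ≤ C * ‖e‖ := (G i).le_of_opNorm_le (hC _) e
    have h2 : ‖e‖ ≤ ‖h‖ := by
      rw [← Submodule.norm_coe, he]
      exact Submodule.Quotient.norm_mk_le M h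
    calc ‖Φ i (s e)‖ ≤ C * ‖e‖ := h1
      _ ≤ max C 0 * ‖h‖ :=
        mul_le_mul (le_max_left _ _) h2 (norm_nonneg _) (le_max_right _ _)

theorem HasFiniteDimensionalCokernel.exists_forall_exists_sub_mem_norm_le {X : Type*}
    [NormedAddCommGroup X] [NormedSpace 𝕜 X] {J : X →L[𝕜] StrongDual 𝕜 Y}
    (hJ : HasFiniteDimensionalCokernel J) (hcl : IsClosed (Set.range J)) (A : Set Y) :
    ∃ C : ℝ, 0 ≤ C ∧ ∀ f h : StrongDual 𝕜 Y, (∃ c : ℝ, ∀ a ∈ A, ‖f a‖ ≤ c) →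
      (∃ x, J x = f + h) →
      ∃ g : StrongDual 𝕜 Y, (∃ y, J y = h - g) ∧ ∀ a ∈ A, ‖g a‖ ≤ C * ‖h‖ := by
  have : FiniteDimensional 𝕜 (StrongDual 𝕜 Y ⧸ J.range) := hJ
  obtain ⟨C, hC0, hC⟩ := _root_.exists_forall_exists_sub_mem_norm_le J.range hcl
    (fun a : A ↦ (NormedSpace.inclusionInDoubleDual 𝕜 Y a).toLinearMap)
  refine ⟨C, hC0, fun f h ⟨c, hc⟩ hx ↦ ?_⟩
  obtain ⟨g, hg, hgA⟩ := hC f h ⟨c, fun a ↦ hc a a.2⟩ hx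
  exact ⟨g, hg, fun a ha ↦ hgA ⟨a, ha⟩⟩

/-- For `J : X → Y^*` with finite-dimensional cokernel and closed range, a point in the bipolar of an
absolutely convex set `A ⊆ Y` with respect to `J` is in the bipolar of a bounded part of `A`. -/
theorem HasFiniteDimensionalCokernel.exists_bipolar_inter_closedBall {X : Type*}
    [NormedAddCommGroup X] [NormedSpace 𝕜 X] {J : X →L[𝕜] StrongDual 𝕜 Y}
    (hJ : HasFiniteDimensionalCokernel J) (hcl : IsClosed (Set.range J)) {A : Set Y}
    (hA : AbsConvex 𝕜 A) (hne : A.Nonempty) {φ : Y}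
    (hφ : ∀ (x : X) (c : ℝ), (∀ a ∈ A, ‖J x a‖ ≤ c) → ‖J x φ‖ ≤ c) :
    ∃ n : ℕ, 1 ≤ n ∧ ∀ (x : X) (c : ℝ),
      (∀ a ∈ A ∩ Metric.closedBall (0 : Y) n, ‖J x a‖ ≤ c) → ‖J x φ‖ ≤ c := by
  obtain ⟨C, hC0, hC⟩ := hJ.exists_forall_exists_sub_mem_norm_le hcl (insert φ A)
  -- The error is `C‖h‖` from `g` on `A`, `C‖h‖` from `g φ` and `‖φ‖‖h‖` from `h φ`, against a gain
  -- of `n‖h‖`.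
  obtain ⟨n, hn⟩ := exists_nat_ge (max 1 (2 * C + ‖φ‖))
  have hn1 : (1 : ℝ) ≤ n := (le_max_left _ _).trans hn
  have hnC : 2 * C + ‖φ‖ ≤ n := (le_max_right _ _).trans hn
  refine ⟨n, by exact_mod_cast hn1, fun x c hx ↦ ?_⟩
  obtain ⟨h, hh⟩ := hA.exists_norm_sub_add_norm_le hne (zero_lt_one.trans_le hn1) (J x) hx
  have hfb : ∃ d : ℝ, ∀ a ∈ insert φ A, ‖(J x - h) a‖ ≤ d := by
    refine ⟨max ‖(J x - h) φ‖ c, ?_⟩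
    rintro a (rfl | ha)
    · exact le_max_left _ _
    · refine le_max_of_le_right (le_trans ?_ (hh a ha))
      rw [sub_apply]
      exact le_add_of_nonneg_right (by positivity)
  obtain ⟨g, ⟨y, hy⟩, hgA⟩ := hC (J x - h) h hfb ⟨x, by simp⟩
  have hxy : ∀ a, J (x - y) a = J x a - h a + g a := fun a ↦ by
    rw [map_sub, hy, sub_apply, sub_apply]
    ring
  have hφy : ‖J (x - y) φ‖ ≤ c - n * ‖h‖ + C * ‖h‖ := by
    refine hφ _ _ fun a ha ↦ ?_
    rw [hxy]
    have h1 := hh a ha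
    have h2 := hgA a (Set.mem_insert_of_mem _ ha)
    have h3 := norm_add_le (J x a - h a) (g a)
    linarith
  have hgφ := hgA φ (Set.mem_insert _ _)
  have hhφ : ‖h φ‖ ≤ ‖h‖ * ‖φ‖ := h.le_opNorm φ
  calc ‖J x φ‖ = ‖J (x - y) φ + (h φ - g φ)‖ := by rw [hxy]; congr 1; ring
    _ ≤ ‖J (x - y) φ‖ + (‖h φ‖ + ‖g φ‖) :=
      (norm_add_le _ _).trans (by gcongr; exact norm_sub_le _ _)
    _ ≤ c + (2 * C + ‖φ‖ - n) * ‖h‖ := by linarith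
    _ ≤ c := by nlinarith [norm_nonneg h]

end Decomposition

theorem theorem3 (𝕜 : Type*) [RCLike 𝕜] (X : Type*) [NormedAddCommGroup X] [NormedSpace 𝕜 X]
    [CompleteSpace X] (hX : IsQuasiReflexive 𝕜 X) (A : Set (StrongDual 𝕜 X))
    (hA : AbsConvex 𝕜 A) :
    weakStarDerivedSet 𝕜 X A = weakStarClosure 𝕜 X A := by
  apply Set.Subset.antisymm
  · refine Set.iUnion_subset fun n ↦ Set.iUnion_subset fun _ ↦ ?_
    exact Set.preimage_mono (closure_mono (Set.image_mono Set.inter_subset_left))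
  intro φ hφ
  have hne : A.Nonempty := by
    by_contra hempty
    rw [Set.not_nonempty_iff_eq_empty] at hempty
    simp [hempty, weakStarClosure] at hφ
  -- Completeness of `X` enters here.
  have hcl : IsClosed (Set.range (NormedSpace.inclusionInDoubleDual 𝕜 X)) :=
    (NormedSpace.inclusionInDoubleDualLi (E := X)
      𝕜).isometry.isUniformInducing.isComplete_range.isClosed
  -- `hA` restated for the scalar action coming from the normed space structure on the dual
  have hA' := AbsConvex.of_smul_mem (𝕜 := 𝕜) (Y := StrongDual 𝕜 X)
    (fun c hc a ha ↦ hA.1.smul_mem hc ha) hA.2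
  obtain ⟨n, hn1, hn⟩ := HasFiniteDimensionalCokernel.exists_bipolar_inter_closedBall
    (Y := StrongDual 𝕜 X) hX hcl hA' hne
    (fun x c hc ↦ norm_apply_le_of_mem_weakStarClosure hφ hc)
  have hball := hA.inter (absConvex_closedBall_zero (𝕜 := 𝕜) (Y := StrongDual 𝕜 X) (r := n))
  have hmem := mem_weakStarClosure_of_forall_norm_apply_le hball hn
  exact Set.mem_iUnion₂.2 ⟨n, hn1, hmem⟩
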